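/- Let $X\in\mathbb R^{m\times n}$ have rank $r$ and let $X=U\Sigma V^T$ be a compact singular value decomposition, i.e. $U\in\mathbb R^{m\times r}$ and $V\in\mathbb R^{n\times r}$ have orthonormal columns and $\Sigma=\mathrm{diag}(\sigma_1,\dots,\sigma_r)$ with $\sigma_1\ge\dots\ge\sigma_r>0$. For a factorization dimension $k$ let $$J(W,S)=\tfrac12\|X-WS\|_F^2,\qquad (W,S)\in\mathcal X=\mathbb R^{m\times k}\times\mathbb R^{k\times n},$$ where $\mathcal X$ carries the inner product $\langle (G,H),(G',H')\rangle=\mathrm{tr}(G^TG')+\mathrm{tr}(H^TH')$. The gradient $\nabla J$ is taken with respect to this inner product, the Hessian $\nabla^2J(W,S)\colon\mathcal X\to\mathcal X$ is the derivative of $\nabla J$ at $(W,S)$, and $\lambda_{\min}$ denotes the least eigenvalue. Let $\mathcal M_0=\{(W,S)\in\mathcal X: W^TW-SS^T=0\}$. Let $1\le q\le\min\{k,r\}$. Select $q$ of the $r$ indices, listed so that the selected singular values $\lambda_1\ge\dots\ge\lambda_q$ (all positive) are in decreasing order, let $\Lambda=\mathrm{diag}(\lambda_1,\dots,\lambda_q)$,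 let $\bar U\in\mathbb R^{m\times q}$, $\bar V\in\mathbb R^{n\times q}$ consist of the corresponding columns of $U$ and $V$, and set $$(W_0,S_0)=\left(\begin{bmatrix}\bar U\Lambda^{1/2} & 0_{m\times(k-q)}\end{bmatrix},\ \begin{bmatrix}\Lambda^{1/2}\bar V^T\\ 0_{(k-q)\times n}\end{bmatrix}\right).$$ Call $(W_0,S_0)$ maximal if $\lambda_j=\sigma_j$ for all $j\in\{1,\dots,q\}$. Then $(W_0,S_0)$ is a critical point of $J$ lying in $\mathcal M_0$. If it is not maximal, there is a least $p\in\{1,\dots,q\}$ with $\lambda_p<\sigma_p$. With this $p$, the following hold: (a) If $q=\min\{k,r\}$ and $(W_0,S_0)$ is maximal, then $(W_0,S_0)$ is a global minimum of $J$. (b) If $q=\min\{k,r\}$ and $(W_0,S_0)$ is not maximal, then $q=k$ and $\lambda_{\min}(\nabla^2J(W_0,S_0))=-(\sigma_p-\lambda_k)$. (c) If $q<\min\{k,r\}$, then $\lambda_{\min}(\nabla^2J(W_0,S_0))=-\sigma_{q+1}$ if $(W_0,S_0)$ is maximal, and $\lambda_{\min}(\nabla^2J(W_0,S_0))=-\sigma_p$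 if it is not. -/

import Mathlib

noncomputable section

/-- The space of pairs `(W, S)` of an `m × k` and a `k × n` real matrix, with the inner product
`⟨(G, H), (G', H')⟩ = ⟨G, G'⟩ + ⟨H, H'⟩` (sums of the products of corresponding entries) and
the associated norm `‖(G, H)‖² = ‖G‖_F² + ‖H‖_F²`. -/
abbrev FactorSpace (m k n : ℕ) : Type :=
  EuclideanSpace ℝ ((Fin m × Fin k) ⊕ (Fin k × Fin n))

namespace FactorSpace

variable {m k n : ℕ}

/-- The pair `(W, S)` as a point of `FactorSpace m k n`. -/
def mk (W : Matrix (Fin m) (Fin k) ℝ) (S : Matrix (Fin k) (Fin n) ℝ) : FactorSpace m k n :=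
  WithLp.toLp 2 (Sum.elim (fun a => W a.1 a.2) (fun b => S b.1 b.2))

/-- The first component of a pair `(W, S)`. -/
def W (z : FactorSpace m k n) : Matrix (Fin m) (Fin k) ℝ :=
  Matrix.of fun i j => z (Sum.inl (i, j))

/-- The second component of a pair `(W, S)`. -/
def S (z : FactorSpace m k n) : Matrix (Fin k) (Fin n) ℝ :=
  Matrix.of fun i j => z (Sum.inr (i, j))

end FactorSpace

open scoped Matrix.Norms.Frobenius in
/-- The matrix factorization objective `J(W, S) = (1/2) ‖X - W S‖_F²`. -/
def factorLoss {m n : ℕ} (k : ℕ) (X : Matrix (Fin m) (Fin n) ℝ) (z : FactorSpace m k n) : ℝ :=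
  (1 / 2) * ‖X - z.W * z.S‖ ^ 2

/-- The balanced set of all `(W, S)` with `Wᵀ W - S Sᵀ = 0`. -/
def balancedSet (m k n : ℕ) : Set (FactorSpace m k n) :=
  {z | z.W.transpose * z.W - z.S * z.S.transpose = 0}

/-- The Hessian map of `f` at `z`: the derivative at `z` of the gradient field of `f`. -/
def hessianMap {E : Type*} [NormedAddCommGroup E] [InnerProductSpace ℝ E] [CompleteSpace E]
    (f : E → ℝ) (z : E) : E →L[ℝ] E :=
  fderiv ℝ (gradient f) z

/-- `c` is the least eigenvalue `λ_min(T)` of the linear map `T`. -/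
def IsMinEigenvalue {E : Type*} [NormedAddCommGroup E] [InnerProductSpace ℝ E]
    (T : E →L[ℝ] E) (c : ℝ) : Prop :=
  IsLeast {μ : ℝ | Module.End.HasEigenvalue (T : E →ₗ[ℝ] E) μ} c

/-- `X = U Σ Vᵀ` is a compact singular value decomposition: `U` and `V` have `r` orthonormal
columns each and `Σ = diag(σ)` with `σ` decreasing and positive. -/
structure IsCompactSVD {m n r : ℕ} (X : Matrix (Fin m) (Fin n) ℝ)
    (U : Matrix (Fin m) (Fin r) ℝ) (σ : Fin r → ℝ) (V : Matrix (Fin n) (Fin r) ℝ) : Prop where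
  left_orthonormal : U.transpose * U = 1
  right_orthonormal : V.transpose * V = 1
  pos : ∀ i, 0 < σ i
  antitone : Antitone σ
  eq_mul : X = U * Matrix.diagonal σ * V.transpose

/-- `[A 0]`: the matrix `A` followed by zero columns, `k` columns in all (for `q ≤ k`). -/
def padCols {m q : ℕ} (k : ℕ) (A : Matrix (Fin m) (Fin q) ℝ) : Matrix (Fin m) (Fin k) ℝ :=
  Matrix.of fun i j => if h : (j : ℕ) < q then A i ⟨j, h⟩ else 0

/-- `[B; 0]`: the matrix `B` on top of zero rows, `k` rows in all (for `q ≤ k`). -/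
def padRows {q n : ℕ} (k : ℕ) (B : Matrix (Fin q) (Fin n) ℝ) : Matrix (Fin k) (Fin n) ℝ :=
  Matrix.of fun j i => if h : (j : ℕ) < q then B ⟨j, h⟩ i else 0

/-- The point `([Ū Λ^{1/2}  0], [Λ^{1/2} V̄ᵀ; 0])`, where the columns of `Ū` and `V̄` are the
columns of `U` and `V` selected by `ι`, and `Λ` is the diagonal matrix of the singular values
selected by `ι`. -/
def balancedPoint {m n r q : ℕ} (k : ℕ) (U : Matrix (Fin m) (Fin r) ℝ) (σ : Fin r → ℝ)
    (V : Matrix (Fin n) (Fin r) ℝ) (ι : Fin q ↪ Fin r) : FactorSpace m k n :=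
  FactorSpace.mk
    (padCols k (U.submatrix id ι * Matrix.diagonal fun j => √(σ (ι j))))
    (padRows k ((Matrix.diagonal fun j => √(σ (ι j))) * (V.submatrix id ι).transpose))

/-- The selection `ι` of `q` singular values is maximal: the `j`-th selected singular value
`λ_j` equals `σ_j` for every `j`. -/
def IsMaximalSelection {r q : ℕ} (hqr : q ≤ r) (σ : Fin r → ℝ) (ι : Fin q ↪ Fin r) : Prop :=
  ∀ j : Fin q, σ (ι j) = σ (Fin.castLE hqr j)

end

/-! Let `E` be the `r × k` matrix that scales and places the selected unit vectors. The critical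
point is `(U E, Eᵀ Vᵀ)`, where `E Eᵀ = diag(σ - d)` and `Eᵀ E = diag(e)`: here `d` holds the
unselected singular values (zero elsewhere) and `e` the selected ones padded by zeros. The residual
is `U diag(d) Vᵀ`, and `diag(d) E = 0` makes the point critical.

The Hessian form at `(G, H)` is `‖G S + W H‖² - 2⟨G H, X - W S⟩`. In the coordinates `A = Uᵀ G`, `B
= H V`, let `T` be the part of `‖A‖² + ‖B‖²` carried by unselected indices. The inner product term
costs at most `(max d) T`, the square is at least `(min e) T`, and `T ≤ ‖(G, H)‖²`; when `min e ≤
max d` the form is thus at least `(min e - max d) ‖(G, H)‖²` (`le_inner_hessianMap`). A matrix unit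
in an unselected row `i` and column `l` gives an eigenvector with eigenvalue `e l - d i`
(`hessianMap_unitDirection`), so the bound is attained.

What remains is counting (`exists_unselected_eq`, `unselected_le`): the largest unselected value is
`σ_p`, or `σ_{q+1}` for a maximal selection, while `min e` is `0` if `q < k` and `λ_k` if `q = k`.
Global minimality is an Eckart–Young argument: projecting `X` onto the column space of `W` captures
a weighted sum of the `σ_i²`, with weights in `[0, 1]` of total at most `k`. -/

noncomputable section

open Matrix FactorSpace

/-! ### Frobenius inner product and Bessel inequalities. -/

section Frobenius

variable {a b c : Type*} [Fintype a] [Fintype b] [Fintype c]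

/-- The Frobenius inner product `tr (Aᵀ B)`. -/
def frob (A B : Matrix a b ℝ) : ℝ := (Aᵀ * B).trace

lemma frob_eq_sum (A B : Matrix a b ℝ) : frob A B = ∑ i, ∑ j, A i j * B i j := by
  simp only [frob, Matrix.trace, Matrix.diag, Matrix.mul_apply, Matrix.transpose_apply]
  exact Finset.sum_comm

lemma frob_self_eq_sum (A : Matrix a b ℝ) : frob A A = ∑ i, ∑ j, A i j ^ 2 := by
  simp only [frob_eq_sum, sq]

lemma frob_self_nonneg (A : Matrix a b ℝ) : 0 ≤ frob A A := by
  rw [frob_self_eq_sum]; positivity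

lemma frob_comm (A B : Matrix a b ℝ) : frob A B = frob B A := by
  simp only [frob_eq_sum, mul_comm]

lemma frob_transpose (A B : Matrix a b ℝ) : frob Aᵀ Bᵀ = frob A B := by
  rw [frob_eq_sum, frob_eq_sum]; exact Finset.sum_comm

lemma frob_add_left (A A' B : Matrix a b ℝ) : frob (A + A') B = frob A B + frob A' B := by
  simp [frob, Matrix.add_mul]

lemma frob_add_right (A B B' : Matrix a b ℝ) : frob A (B + B') = frob A B + frob A B' := by
  simp [frob, Matrix.mul_add]

lemma frob_neg_right (A B : Matrix a b ℝ) : frob A (-B) = -frob A B := by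
  simp [frob]

lemma frob_sub_right (A B B' : Matrix a b ℝ) : frob A (B - B') = frob A B - frob A B' := by
  simp [frob, Matrix.mul_sub]

lemma frob_sub_left (A A' B : Matrix a b ℝ) : frob (A - A') B = frob A B - frob A' B := by
  simp [frob, Matrix.sub_mul]

lemma frob_smul_left (t : ℝ) (A B : Matrix a b ℝ) : frob (t • A) B = t * frob A B := by
  simp [frob]

lemma frob_smul_right (t : ℝ) (A B : Matrix a b ℝ) : frob A (t • B) = t * frob A B := by
  simp [frob]

lemma frob_mul_left (P : Matrix a b ℝ) (A : Matrix b c ℝ) (B : Matrix a c ℝ) :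
    frob (P * A) B = frob A (Pᵀ * B) := by
  simp [frob, Matrix.mul_assoc]

lemma frob_mul_right (P : Matrix b c ℝ) (A : Matrix a b ℝ) (B : Matrix a c ℝ) :
    frob (A * P) B = frob A (B * Pᵀ) := by
  simp only [frob, Matrix.transpose_mul]
  rw [Matrix.mul_assoc, Matrix.trace_mul_comm, Matrix.mul_assoc]

variable [DecidableEq b]

/-- Multiplication by a matrix with orthonormal columns preserves the Frobenius norm. -/
lemma frob_self_mul_left {Q : Matrix a b ℝ} (hQ : Qᵀ * Q = 1) (A : Matrix b c ℝ) :
    frob (Q * A) (Q * A) = frob A A := by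
  rw [frob_mul_left, ← Matrix.mul_assoc, hQ, Matrix.one_mul]

lemma frob_self_mul_right {Q : Matrix a b ℝ} (hQ : Qᵀ * Q = 1) (A : Matrix c b ℝ) :
    frob (A * Qᵀ) (A * Qᵀ) = frob A A := by
  rw [frob_mul_right, Matrix.transpose_transpose, Matrix.mul_assoc, hQ, Matrix.mul_one]

/-- The residual of the orthogonal projection onto the column span of `Q`. -/
lemma frob_self_sub_proj {Q : Matrix a b ℝ} (hQ : Qᵀ * Q = 1) (A : Matrix a c ℝ) :
    frob (A - Q * (Qᵀ * A)) (A - Q * (Qᵀ * A)) = frob A A - frob (Qᵀ * A) (Qᵀ * A) := by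
  have h1 : frob (Q * (Qᵀ * A)) A = frob (Qᵀ * A) (Qᵀ * A) := frob_mul_left _ _ _
  rw [frob_sub_left, frob_sub_right, frob_sub_right, frob_comm A (Q * (Qᵀ * A)), h1,
    frob_self_mul_left hQ]
  ring

/-- Bessel's inequality for matrices. -/
lemma frob_bessel_left {Q : Matrix a b ℝ} (hQ : Qᵀ * Q = 1) (A : Matrix a c ℝ) :
    frob (Qᵀ * A) (Qᵀ * A) ≤ frob A A := by
  have := frob_self_nonneg (A - Q * (Qᵀ * A))
  rw [frob_self_sub_proj hQ] at this
  linarith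

lemma frob_bessel_right {Q : Matrix a b ℝ} (hQ : Qᵀ * Q = 1) (A : Matrix c a ℝ) :
    frob (A * Q) (A * Q) ≤ frob A A := by
  have := frob_bessel_left hQ Aᵀ
  rw [← Matrix.transpose_mul, frob_transpose, frob_transpose] at this
  exact this

end Frobenius

/-! ### Gradient and Hessian of the factorization objective. -/

section Derivatives

variable {m k n : ℕ}

namespace FactorSpace

@[simp] lemma W_mk (A : Matrix (Fin m) (Fin k) ℝ) (B : Matrix (Fin k) (Fin n) ℝ) :
    (mk A B).W = A := rfl

@[simp] lemma S_mk (A : Matrix (Fin m) (Fin k) ℝ) (B : Matrix (Fin k) (Fin n) ℝ) :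
    (mk A B).S = B := rfl

@[simp] lemma W_add (z w : FactorSpace m k n) : (z + w).W = z.W + w.W := rfl
@[simp] lemma S_add (z w : FactorSpace m k n) : (z + w).S = z.S + w.S := rfl
@[simp] lemma W_smul (t : ℝ) (z : FactorSpace m k n) : (t • z).W = t • z.W := rfl
@[simp] lemma S_smul (t : ℝ) (z : FactorSpace m k n) : (t • z).S = t • z.S := rfl

lemma ext_WS {z w : FactorSpace m k n} (h1 : z.W = w.W) (h2 : z.S = w.S) : z = w := by
  ext (⟨i, j⟩ | ⟨i, j⟩)
  · exact congrFun (congrFun h1 i) j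
  · exact congrFun (congrFun h2 i) j

lemma inner_eq (z w : FactorSpace m k n) : inner ℝ z w = frob z.W w.W + frob z.S w.S := by
  simp only [PiLp.inner_apply, Fintype.sum_sum_type, frob_eq_sum, Fintype.sum_prod_type]
  simp [W, S, mul_comm]

end FactorSpace

/-- Once differentiability is known, gradient and Hessian can be read off as linear coefficients of
polynomials in `t`. -/
lemma fderiv_apply_of_line {E F : Type*} [NormedAddCommGroup E] [NormedSpace ℝ E]
    [NormedAddCommGroup F] [NormedSpace ℝ F] {f : E → F} {z h : E} {v : F}
    (hf : DifferentiableAt ℝ f z) (hv : HasDerivAt (fun t : ℝ => f (z + t • h)) v 0) :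
    fderiv ℝ f z h = v :=
  (hf.hasFDerivAt.hasLineDerivAt h).unique hv

lemma factorLoss_eq (X : Matrix (Fin m) (Fin n) ℝ) (z : FactorSpace m k n) :
    factorLoss k X z = (1 / 2) * frob (X - z.W * z.S) (X - z.W * z.S) := by
  rw [factorLoss, Matrix.frobenius_norm_def, frob_self_eq_sum, ← Real.sqrt_eq_rpow, Real.sq_sqrt]
  · simp
  · positivity

lemma differentiable_factorLoss (X : Matrix (Fin m) (Fin n) ℝ) :
    Differentiable ℝ (factorLoss k X) := by
  have : factorLoss k X = fun z : FactorSpace m k n => (1 / 2) * ∑ i, ∑ j,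
      (X i j - ∑ l, z (Sum.inl (i, l)) * z (Sum.inr (l, j))) ^ 2 := by
    funext z
    rw [factorLoss_eq, frob_self_eq_sum]
    simp [Matrix.mul_apply, W, S]
  rw [this]
  fun_prop

/-- The gradient field of the factorization objective. -/
def factorGrad (X : Matrix (Fin m) (Fin n) ℝ) (z : FactorSpace m k n) : FactorSpace m k n :=
  mk (-((X - z.W * z.S) * z.Sᵀ)) (-(z.Wᵀ * (X - z.W * z.S)))

lemma gradient_factorLoss (X : Matrix (Fin m) (Fin n) ℝ) :
    gradient (factorLoss k X) = factorGrad X := by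
  funext z
  refine ext_inner_right ℝ fun h => ?_
  rw [gradient, InnerProductSpace.toDual_symm_apply]
  refine fderiv_apply_of_line (differentiable_factorLoss X z) ?_
  set R := X - z.W * z.S with hR
  set P := h.W * z.S + z.W * h.S with hP
  set Q := h.W * h.S with hQ
  -- Along a line the residual is `R - t P - t² Q`, so the objective is a quartic in `t` with linear
  -- coefficient `-⟨R, P⟩`.
  have key : (fun t : ℝ => factorLoss k X (z + t • h)) = fun t => (1 / 2) * frob R R
      - t * frob R P + t ^ 2 * ((1 / 2) * frob P P - frob R Q) + t ^ 3 * frob P Q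
      + t ^ 4 * ((1 / 2) * frob Q Q) := by
    funext t
    have : X - (z + t • h).W * (z + t • h).S = R - t • P - (t ^ 2) • Q := by
      simp only [W_add, S_add, W_smul, S_smul, Matrix.add_mul, Matrix.mul_add, hR, hP, hQ,
        Matrix.smul_mul, Matrix.mul_smul, smul_add, smul_smul]
      rw [sq]; abel
    rw [factorLoss_eq, this]
    simp only [frob_sub_left, frob_sub_right, frob_smul_left, frob_smul_right, frob_comm P R,
      frob_comm Q R, frob_comm Q P]
    ring
  rw [key]
  have hval : inner ℝ (factorGrad X z) h = -frob R P := by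
    rw [real_inner_comm, inner_eq, factorGrad, W_mk, S_mk, frob_neg_right, frob_neg_right, hP,
      frob_add_right, frob_comm R, frob_comm R, frob_mul_left z.W, frob_mul_right z.S]
    ring
  rw [hval]
  have h1 := hasDerivAt_id (0 : ℝ)
  have := ((((h1.mul_const (frob R P)).const_sub ((1 / 2) * frob R R)).add
    ((hasDerivAt_pow 2 (0 : ℝ)).mul_const ((1 / 2) * frob P P - frob R Q))).add
    ((hasDerivAt_pow 3 (0 : ℝ)).mul_const (frob P Q))).add
    ((hasDerivAt_pow 4 (0 : ℝ)).mul_const ((1 / 2) * frob Q Q))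
  convert this using 1
  · funext t; simp
  · simp

lemma differentiable_factorGrad (X : Matrix (Fin m) (Fin n) ℝ) :
    Differentiable ℝ (factorGrad (k := k) X) := by
  rw [differentiable_euclidean]
  rintro (⟨i, l⟩ | ⟨l, j⟩)
  · have : (fun z : FactorSpace m k n => factorGrad X z (Sum.inl (i, l))) = fun z =>
        -∑ j, (X i j - ∑ l', z (Sum.inl (i, l')) * z (Sum.inr (l', j))) * z (Sum.inr (l, j)) := by
      funext z
      simp [factorGrad, mk, Matrix.mul_apply, W, S]
    rw [this]
    fun_prop
  · have : (fun z : FactorSpace m k n => factorGrad X z (Sum.inr (l, j))) = fun z =>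
        -∑ i, z (Sum.inl (i, l)) * (X i j - ∑ l', z (Sum.inl (i, l')) * z (Sum.inr (l', j))) := by
      funext z
      simp [factorGrad, mk, Matrix.mul_apply, W, S]
    rw [this]
    fun_prop

lemma hessianMap_factorLoss (X : Matrix (Fin m) (Fin n) ℝ) (z h : FactorSpace m k n) :
    hessianMap (factorLoss k X) z h =
      mk ((h.W * z.S + z.W * h.S) * z.Sᵀ - (X - z.W * z.S) * h.Sᵀ)
        (z.Wᵀ * (h.W * z.S + z.W * h.S) - h.Wᵀ * (X - z.W * z.S)) := by
  rw [hessianMap, gradient_factorLoss]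
  refine fderiv_apply_of_line (differentiable_factorGrad X z) ?_
  set R := X - z.W * z.S with hR
  set P := h.W * z.S + z.W * h.S with hP
  set Q := h.W * h.S with hQ
  have key : (fun t : ℝ => factorGrad X (z + t • h)) = fun t => factorGrad X z
      + t • mk (P * z.Sᵀ - R * h.Sᵀ) (z.Wᵀ * P - h.Wᵀ * R)
      + t ^ 2 • mk (P * h.Sᵀ + Q * z.Sᵀ) (h.Wᵀ * P + z.Wᵀ * Q)
      + t ^ 3 • mk (Q * h.Sᵀ) (h.Wᵀ * Q) := by
    funext t
    have : X - (z + t • h).W * (z + t • h).S = R - t • P - (t ^ 2) • Q := by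
      simp only [W_add, S_add, W_smul, S_smul, Matrix.add_mul, Matrix.mul_add, hR, hP, hQ,
        Matrix.smul_mul, Matrix.mul_smul, smul_add, smul_smul]
      rw [sq]; abel
    rw [factorGrad, this]
    apply ext_WS
    · simp only [W_mk, W_add, S_add, W_smul, S_smul, factorGrad, ← hR, Matrix.transpose_add,
        Matrix.transpose_smul, Matrix.mul_add, Matrix.sub_mul, Matrix.mul_smul, Matrix.smul_mul]
      module
    · simp only [S_mk, W_add, S_add, W_smul, S_smul, factorGrad, ← hR, Matrix.transpose_add,
        Matrix.transpose_smul, Matrix.add_mul, Matrix.mul_sub, Matrix.mul_smul, Matrix.smul_mul]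
      module
  rw [key]
  have h1 := hasDerivAt_id (0 : ℝ)
  have := (((h1.smul_const (mk (P * z.Sᵀ - R * h.Sᵀ) (z.Wᵀ * P - h.Wᵀ * R))).const_add
    (factorGrad X z)).add
    ((hasDerivAt_pow 2 (0 : ℝ)).smul_const (mk (P * h.Sᵀ + Q * z.Sᵀ) (h.Wᵀ * P + z.Wᵀ * Q)))).add
    ((hasDerivAt_pow 3 (0 : ℝ)).smul_const (mk (Q * h.Sᵀ) (h.Wᵀ * Q)))
  convert this using 1
  · funext t; simp
  · simp

lemma inner_hessianMap_factorLoss (X : Matrix (Fin m) (Fin n) ℝ) (z h : FactorSpace m k n) :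
    inner ℝ h (hessianMap (factorLoss k X) z h) =
      frob (h.W * z.S + z.W * h.S) (h.W * z.S + z.W * h.S)
        - 2 * frob (h.W * h.S) (X - z.W * z.S) := by
  rw [hessianMap_factorLoss, inner_eq, W_mk, S_mk, frob_sub_right, frob_sub_right,
    ← frob_mul_right, ← frob_mul_right, ← frob_mul_left, ← frob_mul_left]
  set P := h.W * z.S + z.W * h.S with hP
  have : frob P P = frob (h.W * z.S) P + frob (z.W * h.S) P := by
    rw [← frob_add_left]
  rw [this]
  ring

end Derivatives

/-! ### Least Hessian eigenvalue at a point `(U E, Eᵀ Vᵀ)`. -/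

section Spectrum

/-- Compare the diagonal entries of `(A Eᵀ)(A Eᵀ)ᵀ = A (Eᵀ E) Aᵀ`. -/
lemma sum_mul_sq_row {a b c : Type*} [Fintype a] [Fintype b] [Fintype c] [DecidableEq b]
    (A : Matrix a b ℝ) {E : Matrix c b ℝ} {e : b → ℝ} (hE : Eᵀ * E = Matrix.diagonal e) (i : a) :
    ∑ j, (A * Eᵀ) i j ^ 2 = ∑ l, e l * A i l ^ 2 := by
  have h : ((A * Eᵀ) * (A * Eᵀ)ᵀ) i i = (A * (Matrix.diagonal e) * Aᵀ) i i := by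
    rw [← hE, Matrix.transpose_mul, Matrix.transpose_transpose]
    simp only [Matrix.mul_assoc]
  rw [Matrix.mul_apply, Matrix.mul_apply] at h
  simp only [Matrix.mul_diagonal, Matrix.transpose_apply] at h
  simp only [sq, h]
  exact Finset.sum_congr rfl fun l _ => by ring

variable {m n k r : ℕ} {X : Matrix (Fin m) (Fin n) ℝ} {U : Matrix (Fin m) (Fin r) ℝ}
  {σ d : Fin r → ℝ} {V : Matrix (Fin n) (Fin r) ℝ} {E : Matrix (Fin r) (Fin k) ℝ} {e : Fin k → ℝ}

lemma residual_eq (hsvd : IsCompactSVD X U σ V) (hd : E * Eᵀ = Matrix.diagonal (σ - d)) :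
    X - U * E * (Eᵀ * Vᵀ) = U * Matrix.diagonal d * Vᵀ := by
  have : U * E * (Eᵀ * Vᵀ) = U * (E * Eᵀ) * Vᵀ := by simp only [Matrix.mul_assoc]
  rw [this, hd, hsvd.eq_mul, ← Matrix.sub_mul, ← Matrix.mul_sub, Matrix.diagonal_sub]
  congr 3
  funext i
  simp

lemma diagonal_mul_eq_zero (hE : ∀ i, d i = 0 ∨ ∀ l, E i l = 0) : Matrix.diagonal d * E = 0 := by
  ext i l
  rw [Matrix.diagonal_mul]
  rcases hE i with h | h <;> simp [h]

lemma gradient_factorLoss_eq_zero (hsvd : IsCompactSVD X U σ V)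
    (hd : E * Eᵀ = Matrix.diagonal (σ - d))
    (hE : ∀ i, d i = 0 ∨ ∀ l, E i l = 0) :
    gradient (factorLoss k X) (mk (U * E) (Eᵀ * Vᵀ)) = 0 := by
  have hDE := diagonal_mul_eq_zero hE
  have hED : Eᵀ * Matrix.diagonal d = 0 := by
    rw [← Matrix.diagonal_transpose, ← Matrix.transpose_mul, hDE, Matrix.transpose_zero]
  rw [gradient_factorLoss, factorGrad, W_mk, S_mk, residual_eq hsvd hd]
  apply ext_WS
  · simp only [W_mk, Matrix.transpose_mul, Matrix.transpose_transpose]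
    rw [Matrix.mul_assoc, ← Matrix.mul_assoc Vᵀ, hsvd.right_orthonormal, Matrix.one_mul,
      Matrix.mul_assoc, hDE, Matrix.mul_zero, neg_zero]
    rfl
  · simp only [S_mk, Matrix.transpose_mul]
    rw [Matrix.mul_assoc U, Matrix.mul_assoc, ← Matrix.mul_assoc Uᵀ, hsvd.left_orthonormal,
      Matrix.one_mul, ← Matrix.mul_assoc, hED, Matrix.zero_mul, neg_zero]
    rfl

/-- A lower bound for the Hessian quadratic form at a balanced critical point. -/
lemma le_inner_hessianMap (hsvd : IsCompactSVD X U σ V) (hd : E * Eᵀ = Matrix.diagonal (σ - d))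
    (hE : ∀ i, d i = 0 ∨ ∀ l, E i l = 0) (he : Eᵀ * E = Matrix.diagonal e) {c s : ℝ}
    (hd0 : ∀ i, 0 ≤ d i) (hds : ∀ i, d i ≤ s) (hce : ∀ l, c ≤ e l) (hcs : c ≤ s)
    (h : FactorSpace m k n) :
    (c - s) * inner ℝ h h ≤
      inner ℝ h (hessianMap (factorLoss k X) (mk (U * E) (Eᵀ * Vᵀ)) h) := by
  classical
  rw [inner_hessianMap_factorLoss, inner_eq, W_mk, S_mk, residual_eq hsvd hd]
  set G := h.W
  set H := h.S
  set A := Uᵀ * G with hA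
  set B := H * V with hB
  -- Indicator of the unselected indices. Both terms of the form are compared with the same quantity
  -- `T`, not with the full norm.
  let χ : Fin r → ℝ := fun i => if ∀ l, E i l = 0 then 1 else 0
  have hχ0 : ∀ i, 0 ≤ χ i := fun i => by simp only [χ]; split_ifs <;> norm_num
  have hχ1 : ∀ i, χ i ≤ 1 := fun i => by simp only [χ]; split_ifs <;> norm_num
  set T := ∑ i, χ i * ∑ l, (A i l ^ 2 + B l i ^ 2) with hT
  have hTle : T ≤ frob G G + frob H H := by
    have h1 : T ≤ frob A A + frob B B := by
      rw [← frob_transpose B B, frob_self_eq_sum, frob_self_eq_sum, ← Finset.sum_add_distrib]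
      refine Finset.sum_le_sum fun i _ => ?_
      rw [← Finset.sum_add_distrib]
      exact mul_le_of_le_one_left (by positivity) (hχ1 i)
    have h2 := frob_bessel_left hsvd.left_orthonormal G
    have h3 := frob_bessel_right hsvd.right_orthonormal H
    linarith
  have hcross : 2 * frob (G * H) (U * Matrix.diagonal d * Vᵀ) ≤ s * T := by
    have h1 : frob (G * H) (U * Matrix.diagonal d * Vᵀ) = ∑ i, d i * ∑ l, A i l * B l i := by
      rw [frob_comm, frob_mul_right, frob_mul_left, Matrix.transpose_transpose]
      have : Uᵀ * (G * H * V) = A * B := by simp only [hA, hB, Matrix.mul_assoc]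
      rw [this, frob, Matrix.diagonal_transpose]
      simp only [Matrix.trace, Matrix.diag, Matrix.diagonal_mul]
      simp only [Matrix.mul_apply]
    rw [h1, hT, Finset.mul_sum, Finset.mul_sum]
    refine Finset.sum_le_sum fun i _ => ?_
    have h2 : 2 * ∑ l, A i l * B l i ≤ ∑ l, (A i l ^ 2 + B l i ^ 2) := by
      rw [Finset.mul_sum]
      refine Finset.sum_le_sum fun l _ => ?_
      nlinarith [sq_nonneg (A i l - B l i)]
    have h3 : 0 ≤ ∑ l, (A i l ^ 2 + B l i ^ 2) := by positivity
    by_cases hi : ∀ l, E i l = 0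
    · have : χ i = 1 := if_pos hi
      rw [this, one_mul]
      calc 2 * (d i * ∑ l, A i l * B l i) = d i * (2 * ∑ l, A i l * B l i) := by ring
        _ ≤ d i * ∑ l, (A i l ^ 2 + B l i ^ 2) := mul_le_mul_of_nonneg_left h2 (hd0 i)
        _ ≤ _ := mul_le_mul_of_nonneg_right (hds i) h3
    · have : χ i = 0 := if_neg hi
      rw [this, (hE i).resolve_right hi]
      simp
  set M := G * (Eᵀ * Vᵀ) + U * E * H with hM
  have hsq : c * T ≤ frob M M := by
    have hN : Uᵀ * M * V = A * Eᵀ + E * B := by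
      calc Uᵀ * M * V = Uᵀ * G * Eᵀ * (Vᵀ * V) + (Uᵀ * U) * E * (H * V) := by
            simp only [hM, Matrix.mul_add, Matrix.add_mul, Matrix.mul_assoc]
        _ = _ := by
            rw [hsvd.left_orthonormal, hsvd.right_orthonormal, Matrix.mul_one, Matrix.one_mul]
    have h1 : frob (A * Eᵀ + E * B) (A * Eᵀ + E * B) ≤ frob M M := by
      rw [← hN]
      exact (frob_bessel_right hsvd.right_orthonormal _).trans
        (frob_bessel_left hsvd.left_orthonormal _)
    refine le_trans ?_ h1
    -- If row `i` of `E` vanishes then `(E * B) i j = 0`, and if row `j` does then `(A * Eᵀ) i j =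
    -- 0`; so wherever a weight is nonzero the square has no mixed term.
    have h2 : ∀ i j, χ i * (A * Eᵀ) i j ^ 2 + χ j * (Bᵀ * Eᵀ) j i ^ 2
        ≤ (A * Eᵀ + E * B) i j ^ 2 := by
      intro i j
      have hBE : (Bᵀ * Eᵀ) j i = (E * B) i j := by rw [← Matrix.transpose_mul]; rfl
      have hzi : (∀ l, E i l = 0) → (E * B) i j = 0 := fun h => by simp [Matrix.mul_apply, h]
      have hzj : (∀ l, E j l = 0) → (A * Eᵀ) i j = 0 := fun h => by simp [Matrix.mul_apply, h]
      rw [hBE, Matrix.add_apply]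
      by_cases hi : ∀ l, E i l = 0
      · rw [hzi hi]
        have := mul_le_of_le_one_left (sq_nonneg ((A * Eᵀ) i j)) (hχ1 i)
        simpa using this
      · have hχi : χ i = 0 := if_neg hi
        by_cases hj : ∀ l, E j l = 0
        · rw [hzj hj]
          have := mul_le_of_le_one_left (sq_nonneg ((E * B) i j)) (hχ1 j)
          simpa using this
        · have hχj : χ j = 0 := if_neg hj
          rw [hχi, hχj]
          simpa using sq_nonneg _
    calc c * T ≤ ∑ i, χ i * (∑ l, e l * A i l ^ 2 + ∑ l, e l * Bᵀ i l ^ 2) := by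
          rw [hT, Finset.mul_sum]
          refine Finset.sum_le_sum fun i _ => ?_
          rw [mul_left_comm]
          refine mul_le_mul_of_nonneg_left ?_ (hχ0 i)
          rw [Finset.mul_sum, ← Finset.sum_add_distrib]
          refine Finset.sum_le_sum fun l _ => ?_
          rw [← mul_add]
          exact mul_le_mul_of_nonneg_right (hce l) (by positivity)
      _ = ∑ i, ∑ j, (χ i * (A * Eᵀ) i j ^ 2 + χ j * (Bᵀ * Eᵀ) j i ^ 2) := by
          simp only [← sum_mul_sq_row _ he, mul_add, Finset.mul_sum, Finset.sum_add_distrib]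
          congr 1
          exact Finset.sum_comm
      _ ≤ _ := by
          rw [frob_self_eq_sum]
          exact Finset.sum_le_sum fun i _ => Finset.sum_le_sum fun j _ => h2 i j
  -- The form is at least `(c - s) * T`; as `c ≤ s`, enlarging `T` to the full norm only lowers
  -- this.
  have := mul_le_mul_of_nonpos_left hTle (sub_nonpos.2 hcs)
  linarith

/-- The pair `(U Eᵢₗ, Eₗᵢ Vᵀ)`, with `Eᵢₗ` a matrix unit. -/
def unitDirection (U : Matrix (Fin m) (Fin r) ℝ) (V : Matrix (Fin n) (Fin r) ℝ) (i : Fin r)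
    (l : Fin k) : FactorSpace m k n :=
  mk (U * Matrix.single i l (1 : ℝ)) ((Matrix.single i l (1 : ℝ))ᵀ * Vᵀ)

lemma unitDirection_ne_zero (hU : Uᵀ * U = 1) (i : Fin r) (l : Fin k) :
    unitDirection U V i l ≠ 0 := by
  intro h
  have h1 : U * Matrix.single i l (1 : ℝ) = 0 := congrArg FactorSpace.W h
  have h2 : Matrix.single i l (1 : ℝ) = 0 := by
    rw [← Matrix.one_mul (Matrix.single i l (1 : ℝ)), ← hU, Matrix.mul_assoc, h1, Matrix.mul_zero]
  have := congrFun (congrFun h2 i) l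
  simp at this

/-- The matrix unit `T` satisfies `Tᵀ E = 0` because row `i` of `E` vanishes, so the mixed terms
drop out. The others scale: `T (Eᵀ E) = e l • T` and `diag(d) T = d i • T`. -/
lemma hessianMap_unitDirection (hsvd : IsCompactSVD X U σ V)
    (hd : E * Eᵀ = Matrix.diagonal (σ - d)) (he : Eᵀ * E = Matrix.diagonal e) {i : Fin r}
    (hi : ∀ l, E i l = 0) (l : Fin k) :
    hessianMap (factorLoss k X) (mk (U * E) (Eᵀ * Vᵀ)) (unitDirection U V i l) =
      (e l - d i) • unitDirection U V i l := by
  set T : Matrix (Fin r) (Fin k) ℝ := Matrix.single i l 1 with hT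
  have hTE : Tᵀ * E = 0 := by
    ext a b
    rw [Matrix.mul_apply]
    refine Finset.sum_eq_zero fun x _ => ?_
    by_cases hx : x = i
    · rw [hx, hi, mul_zero]
    · rw [hT, Matrix.transpose_apply, Matrix.single_apply_of_row_ne (Ne.symm hx), zero_mul]
  have hET : Eᵀ * T = 0 := by
    rw [← Matrix.transpose_transpose T, ← Matrix.transpose_mul, hTE, Matrix.transpose_zero]
  have hDT : Matrix.diagonal d * T = d i • T := by
    ext a b
    by_cases ha : a = i
    · simp [ha]
    · simp [hT, Matrix.single_apply_of_row_ne (Ne.symm ha)]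
  have hTEE : T * (Eᵀ * E) = e l • T := by
    rw [he]
    ext a b
    by_cases hb : b = l
    · simp [hb, mul_comm]
    · simp [hT, Matrix.single_apply_of_col_ne _ _ (Ne.symm hb)]
  have hTD : Tᵀ * Matrix.diagonal d = d i • Tᵀ := by
    rw [← Matrix.transpose_smul, ← hDT, Matrix.transpose_mul, Matrix.diagonal_transpose]
  have hEET : Eᵀ * E * Tᵀ = e l • Tᵀ := by
    rw [← Matrix.transpose_smul, ← hTEE, Matrix.transpose_mul, Matrix.transpose_mul,
      Matrix.transpose_transpose]
  have hU := hsvd.left_orthonormal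
  have hV := hsvd.right_orthonormal
  rw [hessianMap_factorLoss, unitDirection, W_mk, S_mk, W_mk, S_mk, residual_eq hsvd hd, ← hT]
  apply ext_WS
  · rw [W_mk, W_smul, W_mk]
    calc (U * T * (Eᵀ * Vᵀ) + U * E * (Tᵀ * Vᵀ)) * (Eᵀ * Vᵀ)ᵀ
          - U * Matrix.diagonal d * Vᵀ * (Tᵀ * Vᵀ)ᵀ
        = U * T * Eᵀ * (Vᵀ * V) * E + U * E * Tᵀ * (Vᵀ * V) * E
          - U * Matrix.diagonal d * (Vᵀ * V) * T := by
          simp only [Matrix.add_mul, Matrix.mul_assoc, Matrix.transpose_mul,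
            Matrix.transpose_transpose]
      _ = U * (T * (Eᵀ * E)) + U * E * (Tᵀ * E) - U * (Matrix.diagonal d * T) := by
          rw [hV]; simp only [Matrix.mul_one, Matrix.mul_assoc]
      _ = _ := by
          rw [hTEE, hTE, hDT, Matrix.mul_zero, add_zero, Matrix.mul_smul, Matrix.mul_smul,
            sub_smul]
  · rw [S_mk, S_smul, S_mk]
    calc (U * E)ᵀ * (U * T * (Eᵀ * Vᵀ) + U * E * (Tᵀ * Vᵀ))
          - (U * T)ᵀ * (U * Matrix.diagonal d * Vᵀ)
        = Eᵀ * (Uᵀ * U) * T * Eᵀ * Vᵀ + Eᵀ * (Uᵀ * U) * E * Tᵀ * Vᵀ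
          - Tᵀ * (Uᵀ * U) * Matrix.diagonal d * Vᵀ := by
          simp only [Matrix.mul_add, Matrix.mul_assoc, Matrix.transpose_mul]
      _ = (Eᵀ * T) * Eᵀ * Vᵀ + (Eᵀ * E * Tᵀ) * Vᵀ - (Tᵀ * Matrix.diagonal d) * Vᵀ := by
          rw [hU]; simp only [Matrix.mul_one]
      _ = _ := by
          rw [hET, hEET, hTD, Matrix.zero_mul, Matrix.zero_mul, zero_add, Matrix.smul_mul,
            Matrix.smul_mul, sub_smul]

/-- The least eigenvalue of the Hessian at a balanced critical point. -/
lemma isMinEigenvalue_hessianMap (hsvd : IsCompactSVD X U σ V)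
    (hd : E * Eᵀ = Matrix.diagonal (σ - d)) (hE : ∀ i, d i = 0 ∨ ∀ l, E i l = 0)
    (he : Eᵀ * E = Matrix.diagonal e) (hd0 : ∀ i, 0 ≤ d i) {i : Fin r} (hi : ∀ l, E i l = 0)
    (hdi : ∀ j, d j ≤ d i) {l : Fin k} (hel : ∀ l', e l ≤ e l') (hle : e l ≤ d i) :
    IsMinEigenvalue (hessianMap (factorLoss k X) (mk (U * E) (Eᵀ * Vᵀ))) (e l - d i) := by
  refine ⟨Module.End.hasEigenvalue_of_hasEigenvector (x := unitDirection U V i l)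
    ⟨Module.End.mem_eigenspace_iff.2 (hessianMap_unitDirection hsvd hd he hi l),
      unitDirection_ne_zero hsvd.left_orthonormal i l⟩, ?_⟩
  intro μ hμ
  obtain ⟨h, hh⟩ := hμ.exists_hasEigenvector
  have h1 := le_inner_hessianMap hsvd hd hE he hd0 hdi hel hle h
  have h2 : hessianMap (factorLoss k X) (mk (U * E) (Eᵀ * Vᵀ)) h = μ • h := hh.apply_eq_smul
  rw [h2, real_inner_smul_right] at h1
  exact le_of_mul_le_mul_right h1 (real_inner_self_pos.2 hh.2)

end Spectrum

/-! ### Counting selected and unselected singular values. -/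

section Selection

variable {r q : ℕ} {σ : Fin r → ℝ} {ι : Fin q ↪ Fin r}

/-- The `j`-th largest selected value is at most the `j`-th largest value. -/
lemma selected_le (hqr : q ≤ r) (hσ : Antitone σ) (hι : Antitone fun j => σ (ι j)) (j : Fin q) :
    σ (ι j) ≤ σ (Fin.castLE hqr j) := by
  by_contra! hlt
  -- Pigeonhole: otherwise `j + 1` distinct selected indices would lie among the first `j`.
  have hmap : ∀ x ∈ Finset.Iic j, ι x ∈ Finset.Iio (Fin.castLE hqr j) := by
    intro x hx
    rw [Finset.mem_Iio]
    by_contra! hle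
    have h1 := hσ hle
    have h2 : σ (ι j) ≤ σ (ι x) := hι (Finset.mem_Iic.1 hx)
    linarith
  have := Finset.card_le_card_of_injOn _ hmap ι.injective.injOn
  simp at this

/-- If the selection agrees in value with the first `p` values, every value above `σ p` is
selected. -/
lemma unselected_le (hqr : q ≤ r) (hσ : Antitone σ) (P : Fin r)
    (hP : ∀ j : Fin q, (j : ℕ) < P → σ (ι j) = σ (Fin.castLE hqr j)) (hPq : (P : ℕ) ≤ q)
    (i : Fin r) (hi : i ∉ Set.range ι) : σ i ≤ σ P := by
  by_contra! hlt
  let A : Finset (Fin r) := Finset.univ.filter fun i => σ P < σ i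
  have hA : ∀ x ∈ A, x < P := by
    intro x hx
    by_contra! hle
    exact absurd (Finset.mem_filter.1 hx).2 (not_lt.2 (hσ hle))
  -- On the finite set of indices with value above `σ P`, the selection is an injective self-map,
  -- hence onto; so it hits `i`.
  let f : A → A := fun x =>
    have hx : (x : ℕ) < P := hA x x.2
    ⟨ι ⟨x, hx.trans_le hPq⟩, Finset.mem_filter.2 ⟨Finset.mem_univ _, by
      rw [hP _ hx]; exact (Finset.mem_filter.1 x.2).2⟩⟩
  have hf : Function.Injective f := by
    intro x y hxy
    have := ι.injective (Subtype.ext_iff.1 hxy)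
    exact Subtype.ext (Fin.ext (Fin.mk.inj_iff.1 this))
  obtain ⟨x, hx⟩ := (Finite.injective_iff_surjective.1 hf)
    ⟨i, Finset.mem_filter.2 ⟨Finset.mem_univ _, hlt⟩⟩
  exact hi ⟨_, Subtype.ext_iff.1 hx⟩

/-- If only the first `p` selected values can reach `σ p`, some value `≥ σ p` is not selected. -/
lemma exists_unselected_ge (hσ : Antitone σ) (P : Fin r)
    (hP : ∀ j : Fin q, (P : ℕ) ≤ j → σ (ι j) < σ P) :
    ∃ i, i ∉ Set.range ι ∧ σ P ≤ σ i := by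
  by_contra! h
  -- Pigeonhole again: the `P + 1` indices up to `P` would all be selected, at only `P` positions.
  have hch : ∀ i ≤ P, ∃ j : Fin q, (j : ℕ) < P ∧ ι j = i := by
    intro i hi
    have hle := hσ hi
    by_cases hmem : i ∈ Set.range ι
    · obtain ⟨j, rfl⟩ := hmem
      refine ⟨j, ?_, rfl⟩
      by_contra! hj
      exact absurd (hP j hj) (not_lt.2 hle)
    · exact absurd (h i hmem) (not_lt.2 hle)
  choose! g hg1 hg2 using hch
  have := Finset.card_le_card_of_injOn (s := Finset.Iic P) (t := Finset.range P)
    (fun i => if hi : i ≤ P then (g i hi : ℕ) else 0) (by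
      intro i hi
      have hi' : i ≤ P := Finset.mem_Iic.1 hi
      simp [hi', hg1 i hi']) (by
      intro i hi j hj hij
      have hi' : i ≤ P := by simpa using hi
      have hj' : j ≤ P := by simpa using hj
      simp only [hi', hj', dite_true] at hij
      rw [← hg2 i hi', ← hg2 j hj', Fin.ext hij])
  simp at this

/-- Allowing `P = q` covers a maximal selection, where `hP'` is vacuous; `P = p` is the non-maximal
case. -/
lemma exists_unselected_eq (hqr : q ≤ r) (hσ : Antitone σ) (P : Fin r)
    (hP : ∀ j : Fin q, (j : ℕ) < P → σ (ι j) = σ (Fin.castLE hqr j)) (hPq : (P : ℕ) ≤ q)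
    (hP' : ∀ j : Fin q, (P : ℕ) ≤ j → σ (ι j) < σ P) :
    ∃ i, i ∉ Set.range ι ∧ σ i = σ P := by
  obtain ⟨i, hi, hle⟩ := exists_unselected_ge hσ P hP'
  exact ⟨i, hi, le_antisymm (unselected_le hqr hσ P hP hPq i hi) hle⟩

end Selection

/-! ### Eckart–Young lower bound for the objective. -/

section GlobalMinimum

/-- Every matrix factors through its column space by a matrix with orthonormal columns. -/
lemma exists_orthonormal_factor {m k : ℕ} (W : Matrix (Fin m) (Fin k) ℝ) :
    ∃ (p : ℕ) (Q : Matrix (Fin m) (Fin p) ℝ), p ≤ k ∧ Qᵀ * Q = 1 ∧ W = Q * (Qᵀ * W) := by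
  let w : Fin k → EuclideanSpace ℝ (Fin m) := fun l => WithLp.toLp 2 fun i => W i l
  let K := Submodule.span ℝ (Set.range w)
  let b := stdOrthonormalBasis ℝ K
  have hent : ∀ x y : EuclideanSpace ℝ (Fin m), inner ℝ x y = ∑ i, x i * y i := by
    intro x y
    simp [PiLp.inner_apply, mul_comm]
  refine ⟨Module.finrank ℝ K, Matrix.of fun i a => (b a : EuclideanSpace ℝ (Fin m)) i,
    ?_, ?_, ?_⟩
  · exact (finrank_range_le_card (R := ℝ) w).trans_eq (Fintype.card_fin k)
  · ext a a'
    have := orthonormal_iff_ite.1 b.orthonormal a a'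
    rw [Submodule.coe_inner, hent] at this
    simpa [Matrix.mul_apply, Matrix.one_apply] using this
  · ext i l
    have hmem : w l ∈ K := Submodule.subset_span ⟨l, rfl⟩
    have h1 := congrArg (fun x : K => (x : EuclideanSpace ℝ (Fin m)) i) (b.sum_repr' ⟨w l, hmem⟩)
    simp only [Submodule.coe_sum, Submodule.coe_smul, Submodule.coe_inner, hent] at h1
    have h2 : W i l = w l i := rfl
    rw [h2]
    simp only [Matrix.mul_apply, Matrix.transpose_apply, Matrix.of_apply]
    rw [← h1]
    simp [mul_comm, w]

variable {m n k r : ℕ} {X : Matrix (Fin m) (Fin n) ℝ} {U : Matrix (Fin m) (Fin r) ℝ}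
  {σ : Fin r → ℝ} {V : Matrix (Fin n) (Fin r) ℝ}

lemma frob_self_svd {d : Fin r → ℝ} (hU : Uᵀ * U = 1) (hV : Vᵀ * V = 1) :
    frob (U * Matrix.diagonal d * Vᵀ) (U * Matrix.diagonal d * Vᵀ) = ∑ i, d i ^ 2 := by
  rw [frob_self_mul_right hV, frob_self_mul_left hU, frob, Matrix.diagonal_transpose,
    Matrix.diagonal_mul_diagonal, Matrix.trace_diagonal]
  simp only [sq]

/-- A lower bound for the factorization objective, with weights `c i ∈ [0, 1]` of total mass at
most `k`. -/
lemma exists_weights_le_factorLoss (hsvd : IsCompactSVD X U σ V) (z : FactorSpace m k n) :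
    ∃ c : Fin r → ℝ, (∀ i, 0 ≤ c i) ∧ (∀ i, c i ≤ 1) ∧ ∑ i, c i ≤ k ∧
      (1 / 2) * (∑ i, σ i ^ 2 - ∑ i, c i * σ i ^ 2) ≤ factorLoss k X z := by
  obtain ⟨p, Q, hpk, hQ, hW⟩ := exists_orthonormal_factor z.W
  have hU := hsvd.left_orthonormal
  have hV := hsvd.right_orthonormal
  -- The weight of `i` is the squared length of the projection of the `i`-th column of `U` onto the
  -- column space of `W`. Bessel for `Q` bounds each weight by `1`; Bessel for `U` bounds their sum
  -- by `‖Q‖² = p ≤ k`.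
  refine ⟨fun i => ∑ a, (Qᵀ * U) a i ^ 2, fun i => by positivity, fun i => ?_, ?_, ?_⟩
  · have h1 := frob_bessel_left hQ (U.submatrix id fun _ : Unit => i)
    have h2 : (Uᵀ * U) i i = 1 := by rw [hU, Matrix.one_apply_eq]
    simp only [frob_self_eq_sum, Matrix.mul_apply, Matrix.submatrix_apply, id, Finset.univ_unique,
      Finset.sum_singleton, Matrix.transpose_apply] at h1 h2 ⊢
    simp only [sq] at h1 h2 ⊢
    linarith
  · have h1 := frob_bessel_left hU Q
    have h2 : frob Q Q = p := by simp [frob, hQ]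
    have h3 : ∑ i, ∑ a, (Qᵀ * U) a i ^ 2 = frob (Uᵀ * Q) (Uᵀ * Q) := by
      rw [← frob_transpose, frob_self_eq_sum, Finset.sum_comm, Matrix.transpose_mul,
        Matrix.transpose_transpose]
    rw [h3]
    have : (p : ℝ) ≤ k := by exact_mod_cast hpk
    linarith
  · have h1 : frob X X = ∑ i, σ i ^ 2 := by rw [hsvd.eq_mul, frob_self_svd hU hV]
    have h2 : frob (Qᵀ * X) (Qᵀ * X) = ∑ i, (∑ a, (Qᵀ * U) a i ^ 2) * σ i ^ 2 := by
      rw [hsvd.eq_mul, ← Matrix.mul_assoc, ← Matrix.mul_assoc, frob_self_mul_right hV,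
        frob_self_eq_sum, Finset.sum_comm]
      simp only [Matrix.mul_diagonal, mul_pow, Finset.sum_mul]
    set M := X - z.W * z.S with hM
    -- The projection fixes `W S`, so the part of the residual orthogonal to the column space does
    -- not depend on `S`.
    have h3 : M - Q * (Qᵀ * M) = X - Q * (Qᵀ * X) := by
      have : Q * (Qᵀ * (z.W * z.S)) = z.W * z.S := by
        rw [← Matrix.mul_assoc Qᵀ, ← Matrix.mul_assoc Q, ← hW]
      rw [hM, Matrix.mul_sub, Matrix.mul_sub, this]
      abel
    have h4 := frob_self_sub_proj hQ M
    rw [h3, frob_self_sub_proj hQ X, h1, h2] at h4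
    have h5 := frob_self_nonneg (Qᵀ * M)
    rw [factorLoss_eq, ← hM]
    linarith

/-- Weights in `[0, 1]` of total mass at most `#s` are best placed on a set `s` of largest
values. -/
lemma sum_weights_le {ι : Type*} [Fintype ι] (c f : ι → ℝ) (s : Finset ι) (t : ℝ) (ht : 0 ≤ t)
    (hc0 : ∀ i, 0 ≤ c i) (hc1 : ∀ i, c i ≤ 1) (hc : ∑ i, c i ≤ s.card)
    (hs : ∀ i ∈ s, t ≤ f i) (hs' : ∀ i ∉ s, f i ≤ t) :
    ∑ i, c i * f i ≤ ∑ i ∈ s, f i := by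
  classical
  -- Shifted by the threshold `t`, the values are nonnegative on `s` and nonpositive off it; undoing
  -- the shift uses `hc` and `0 ≤ t`.
  have h1 : ∑ i, c i * (f i - t) ≤ ∑ i ∈ s, (f i - t) := by
    rw [← Finset.sum_add_sum_compl s]
    have hin : ∑ i ∈ s, c i * (f i - t) ≤ ∑ i ∈ s, (f i - t) := Finset.sum_le_sum fun i hi =>
      mul_le_of_le_one_left (sub_nonneg.2 (hs i hi)) (hc1 i)
    have hout : ∑ i ∈ sᶜ, c i * (f i - t) ≤ 0 := Finset.sum_nonpos fun i hi =>
      mul_nonpos_of_nonneg_of_nonpos (hc0 i) (sub_nonpos.2 (hs' i (Finset.mem_compl.1 hi)))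
    linarith
  have h2 : ∑ i, c i * (f i - t) = ∑ i, c i * f i - (∑ i, c i) * t := by
    simp only [mul_sub, Finset.sum_sub_distrib, Finset.sum_mul]
  have h3 : ∑ i ∈ s, (f i - t) = ∑ i ∈ s, f i - s.card * t := by
    simp [Finset.sum_sub_distrib]
  have h4 := mul_le_mul_of_nonneg_right hc ht
  linarith

end GlobalMinimum

/-! ### The balanced points as instances of `(U E, Eᵀ Vᵀ)`. -/

section BalancedPoint

variable {m n k r q : ℕ} {X : Matrix (Fin m) (Fin n) ℝ} {U : Matrix (Fin m) (Fin r) ℝ}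
  {σ : Fin r → ℝ} {V : Matrix (Fin n) (Fin r) ℝ}

open Classical in
/-- The `r × k` matrix whose column `l < q` is `√(σ (ι l))` times the unit vector at `ι l` and
whose other columns vanish. -/
def selectionMatrix (k : ℕ) (σ : Fin r → ℝ) (ι : Fin q ↪ Fin r) : Matrix (Fin r) (Fin k) ℝ :=
  Matrix.of fun i l => if ∃ h : (l : ℕ) < q, ι ⟨l, h⟩ = i then √(σ i) else 0

open Classical in
/-- The unselected singular values, with the selected ones replaced by `0`. -/
def unselected (σ : Fin r → ℝ) (ι : Fin q ↪ Fin r) (i : Fin r) : ℝ :=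
  if i ∈ Set.range ι then 0 else σ i

/-- The selected singular values, extended by `0` to `k` entries. -/
def selectedPadded (k : ℕ) (σ : Fin r → ℝ) (ι : Fin q ↪ Fin r) (l : Fin k) : ℝ :=
  if h : (l : ℕ) < q then σ (ι ⟨l, h⟩) else 0

lemma selectionMatrix_apply_of_lt (ι : Fin q ↪ Fin r) (i : Fin r) {l : Fin k} (h : (l : ℕ) < q) :
    selectionMatrix k σ ι i l = if ι ⟨l, h⟩ = i then √(σ i) else 0 := by
  simp [selectionMatrix, h]

lemma selectionMatrix_apply_of_not_lt (ι : Fin q ↪ Fin r) (i : Fin r) {l : Fin k}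
    (h : ¬ (l : ℕ) < q) : selectionMatrix k σ ι i l = 0 := by
  simp [selectionMatrix, h]

lemma selectionMatrix_row_eq_zero {ι : Fin q ↪ Fin r} {i : Fin r} (hi : i ∉ Set.range ι)
    (l : Fin k) : selectionMatrix k σ ι i l = 0 := by
  rw [selectionMatrix, Matrix.of_apply, if_neg]
  rintro ⟨h, rfl⟩
  exact hi ⟨_, rfl⟩

lemma balancedPoint_eq (ι : Fin q ↪ Fin r) :
    balancedPoint k U σ V ι =
      mk (U * selectionMatrix k σ ι) ((selectionMatrix k σ ι)ᵀ * Vᵀ) := by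
  apply ext_WS
  · ext i l
    simp only [balancedPoint, W_mk, padCols, Matrix.of_apply,
      Matrix.mul_apply (N := selectionMatrix k σ ι)]
    split_ifs with h
    · simp [selectionMatrix_apply_of_lt ι _ h, Matrix.mul_diagonal]
    · simp [selectionMatrix_apply_of_not_lt ι _ h]
  · ext l j
    simp only [balancedPoint, S_mk, padRows, Matrix.of_apply,
      Matrix.mul_apply (M := (selectionMatrix k σ ι)ᵀ), Matrix.transpose_apply]
    split_ifs with h
    · simp [selectionMatrix_apply_of_lt ι _ h, Matrix.diagonal_mul]
    · simp [selectionMatrix_apply_of_not_lt ι _ h]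

lemma selectionMatrix_transpose_mul_self (hσ : ∀ i, 0 ≤ σ i) (ι : Fin q ↪ Fin r) :
    (selectionMatrix k σ ι)ᵀ * selectionMatrix k σ ι =
      Matrix.diagonal (selectedPadded k σ ι) := by
  ext l l'
  simp only [Matrix.mul_apply, Matrix.transpose_apply]
  by_cases h : (l : ℕ) < q
  · simp only [selectionMatrix_apply_of_lt ι _ h, ite_mul, zero_mul, Finset.sum_ite_eq,
      Finset.mem_univ, if_true]
    by_cases hl : l = l'
    · subst hl
      simp [selectionMatrix_apply_of_lt ι _ h, selectedPadded, h, Real.mul_self_sqrt (hσ _)]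
    · rw [Matrix.diagonal_apply_ne _ hl]
      by_cases h' : (l' : ℕ) < q
      · rw [selectionMatrix_apply_of_lt ι _ h', if_neg, mul_zero]
        intro heq
        exact hl (Fin.ext (Fin.mk.inj_iff.1 (ι.injective heq)).symm)
      · rw [selectionMatrix_apply_of_not_lt ι _ h', mul_zero]
  · simp only [selectionMatrix_apply_of_not_lt ι _ h, zero_mul, Finset.sum_const_zero]
    by_cases hl : l = l'
    · simp [hl, selectedPadded, hl ▸ h]
    · rw [Matrix.diagonal_apply_ne _ hl]

/-- Since `q ≤ k`, every selected index has its own column, the only nonzero entry in its row. -/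
lemma selectionMatrix_mul_transpose_self (hqk : q ≤ k) (hσ : ∀ i, 0 ≤ σ i) (ι : Fin q ↪ Fin r) :
    selectionMatrix k σ ι * (selectionMatrix k σ ι)ᵀ =
      Matrix.diagonal (σ - unselected σ ι) := by
  ext i i'
  simp only [Matrix.mul_apply, Matrix.transpose_apply]
  by_cases hi : i ∈ Set.range ι
  · obtain ⟨j, rfl⟩ := hi
    rw [Finset.sum_eq_single (Fin.castLE hqk j)]
    · rw [selectionMatrix_apply_of_lt ι _ (l := Fin.castLE hqk j) j.2,
        selectionMatrix_apply_of_lt ι _ (l := Fin.castLE hqk j) j.2]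
      by_cases hii : ι j = i'
      · subst hii
        simp [unselected, Real.mul_self_sqrt (hσ _)]
      · simp [hii]
    · intro l _ hl
      by_cases h : (l : ℕ) < q
      · rw [selectionMatrix_apply_of_lt ι _ h, if_neg, zero_mul]
        intro heq
        have hlj : (⟨l, h⟩ : Fin q) = j := ι.injective heq
        exact hl (Fin.ext (Fin.mk.inj_iff.1 hlj))
      · rw [selectionMatrix_apply_of_not_lt ι _ h, zero_mul]
    · simp
  · simp only [selectionMatrix_row_eq_zero hi, zero_mul, Finset.sum_const_zero]
    by_cases hii : i = i'
    · subst hii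
      simp only [Matrix.diagonal_apply_eq, Pi.sub_apply, unselected, if_neg hi, sub_self]
    · rw [Matrix.diagonal_apply_ne _ hii]

lemma unselected_eq_zero_or (ι : Fin q ↪ Fin r) (i : Fin r) :
    unselected σ ι i = 0 ∨ ∀ l, selectionMatrix k σ ι i l = 0 := by
  by_cases hi : i ∈ Set.range ι
  · exact Or.inl (if_pos hi)
  · exact Or.inr (selectionMatrix_row_eq_zero hi)

lemma unselected_nonneg (hσ : ∀ i, 0 ≤ σ i) (ι : Fin q ↪ Fin r) (i : Fin r) :
    0 ≤ unselected σ ι i := by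
  unfold unselected
  split_ifs
  exacts [le_rfl, hσ i]

lemma balancedPoint_mem_balancedSet (hsvd : IsCompactSVD X U σ V) (ι : Fin q ↪ Fin r) :
    balancedPoint k U σ V ι ∈ balancedSet m k n := by
  rw [balancedPoint_eq]
  set E := selectionMatrix k σ ι
  show (U * E)ᵀ * (U * E) - (Eᵀ * Vᵀ) * (Eᵀ * Vᵀ)ᵀ = 0
  have h1 : (U * E)ᵀ * (U * E) = Eᵀ * (Uᵀ * U) * E := by
    simp only [Matrix.transpose_mul, Matrix.mul_assoc]
  have h2 : (Eᵀ * Vᵀ) * (Eᵀ * Vᵀ)ᵀ = Eᵀ * (Vᵀ * V) * E := by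
    simp only [Matrix.transpose_mul, Matrix.mul_assoc, Matrix.transpose_transpose]
  rw [h1, h2, hsvd.left_orthonormal, hsvd.right_orthonormal, sub_self]

lemma gradient_balancedPoint (hsvd : IsCompactSVD X U σ V) (hqk : q ≤ k) (ι : Fin q ↪ Fin r) :
    gradient (factorLoss k X) (balancedPoint k U σ V ι) = 0 := by
  rw [balancedPoint_eq]
  exact gradient_factorLoss_eq_zero hsvd
    (selectionMatrix_mul_transpose_self hqk (fun i => (hsvd.pos i).le) ι)
    (unselected_eq_zero_or ι)

lemma isMinEigenvalue_balancedPoint (hsvd : IsCompactSVD X U σ V) (hqk : q ≤ k)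
    (ι : Fin q ↪ Fin r) {i : Fin r} (hi : i ∉ Set.range ι)
    (hmax : ∀ j, j ∉ Set.range ι → σ j ≤ σ i) {l : Fin k}
    (hel : ∀ l', selectedPadded k σ ι l ≤ selectedPadded k σ ι l')
    (hle : selectedPadded k σ ι l ≤ σ i) :
    IsMinEigenvalue (hessianMap (factorLoss k X) (balancedPoint k U σ V ι))
      (selectedPadded k σ ι l - σ i) := by
  have hσ : ∀ i, 0 ≤ σ i := fun i => (hsvd.pos i).le
  have hu : unselected σ ι i = σ i := if_neg hi
  have := isMinEigenvalue_hessianMap hsvd (selectionMatrix_mul_transpose_self hqk hσ ι)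
    (unselected_eq_zero_or ι) (selectionMatrix_transpose_mul_self hσ ι) (unselected_nonneg hσ ι)
    (selectionMatrix_row_eq_zero hi) (fun j => ?_) hel (hle.trans_eq hu.symm)
  · rwa [hu, ← balancedPoint_eq] at this
  · rw [hu]
    by_cases hj : j ∈ Set.range ι
    · exact (if_pos hj).trans_le (hσ i)
    · exact (if_neg hj).trans_le (hmax j hj)

/-- With unused columns in the factorization, the least Hessian eigenvalue is minus the largest
unselected singular value. -/
lemma isMinEigenvalue_of_lt (hsvd : IsCompactSVD X U σ V) (hqk : q < k)
    (ι : Fin q ↪ Fin r) {i : Fin r} (hi : i ∉ Set.range ι)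
    (hmax : ∀ j, j ∉ Set.range ι → σ j ≤ σ i) :
    IsMinEigenvalue (hessianMap (factorLoss k X) (balancedPoint k U σ V ι)) (-σ i) := by
  -- Counting from zero, column `q` is the first zero column.
  have h0 : selectedPadded k σ ι ⟨q, hqk⟩ = 0 := dif_neg (lt_irrefl q)
  have := isMinEigenvalue_balancedPoint hsvd hqk.le ι hi hmax (l := ⟨q, hqk⟩) (fun l' => ?_)
    (h0.trans_le (hsvd.pos i).le)
  · rwa [h0, zero_sub] at this
  · rw [h0, selectedPadded]
    split_ifs
    exacts [(hsvd.pos _).le, le_rfl]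

lemma factorLoss_balancedPoint (hsvd : IsCompactSVD X U σ V) (hqk : q ≤ k) (ι : Fin q ↪ Fin r) :
    factorLoss k X (balancedPoint k U σ V ι) = (1 / 2) * ∑ i, unselected σ ι i ^ 2 := by
  rw [balancedPoint_eq, factorLoss_eq, W_mk, S_mk,
    residual_eq hsvd (selectionMatrix_mul_transpose_self hqk (fun i => (hsvd.pos i).le) ι),
    frob_self_svd hsvd.left_orthonormal hsvd.right_orthonormal]

lemma sum_unselected_sq (ι : Fin q ↪ Fin r) :
    ∑ i, unselected σ ι i ^ 2 = ∑ i, σ i ^ 2 - ∑ i ∈ Finset.univ.map ι, σ i ^ 2 := by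
  classical
  rw [eq_sub_iff_add_eq, ← Finset.sum_compl_add_sum (Finset.univ.map ι) fun i => σ i ^ 2,
    ← Finset.sum_compl_add_sum (Finset.univ.map ι) fun i => unselected σ ι i ^ 2]
  have h1 : ∑ i ∈ Finset.univ.map ι, unselected σ ι i ^ 2 = 0 :=
    Finset.sum_eq_zero fun i hi => by
      have : i ∈ Set.range ι := by simpa using hi
      simp only [unselected, if_pos this, zero_pow two_ne_zero]
  have h2 : ∑ i ∈ (Finset.univ.map ι)ᶜ, unselected σ ι i ^ 2 =
      ∑ i ∈ (Finset.univ.map ι)ᶜ, σ i ^ 2 :=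
    Finset.sum_congr rfl fun i hi => by
      have : i ∉ Set.range ι := by simpa using hi
      simp only [unselected, if_neg this]
  rw [h1, h2, add_zero]

/-- A maximal selection of `min k r` singular values gives a global minimum. -/
lemma factorLoss_balancedPoint_le (hsvd : IsCompactSVD X U σ V) (hq : 1 ≤ q) (hqk : q ≤ k)
    (hqr : q ≤ r) {ι : Fin q ↪ Fin r} (hι : Antitone fun j => σ (ι j)) (hqm : q = min k r)
    (hmax : IsMaximalSelection hqr σ ι) (z : FactorSpace m k n) :
    factorLoss k X (balancedPoint k U σ V ι) ≤ factorLoss k X z := by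
  rw [factorLoss_balancedPoint hsvd hqk, sum_unselected_sq]
  obtain ⟨c, hc0, hc1, hc, hle⟩ := exists_weights_le_factorLoss hsvd z
  refine le_trans ?_ hle
  -- The smallest selected value, squared, serves as threshold in `sum_weights_le`; it exists
  -- because `1 ≤ q`.
  let last : Fin q := ⟨q - 1, by omega⟩
  have hcard : (Finset.univ.map ι).card = q := by simp
  have hsum : ∑ i, c i ≤ (Finset.univ.map ι).card := by
    rw [hcard]
    rcases min_choice k r with h | h
    · rwa [hqm, h]
    · calc ∑ i, c i ≤ ∑ _i : Fin r, (1 : ℝ) := Finset.sum_le_sum fun i _ => hc1 i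
        _ = q := by rw [hqm, h]; simp
  have := sum_weights_le c (fun i => σ i ^ 2) (Finset.univ.map ι) (σ (ι last) ^ 2) (sq_nonneg _)
    hc0 hc1 hsum (fun i hi => ?_) (fun i hi => ?_)
  · linarith
  · obtain ⟨j, -, rfl⟩ := Finset.mem_map.1 hi
    exact pow_le_pow_left₀ (hsvd.pos _).le (hι (Fin.le_def.2 (by simp only [last]; omega))) 2
  · refine pow_le_pow_left₀ (hsvd.pos _).le ?_ 2
    rw [hmax last]
    exact unselected_le hqr hsvd.antitone _ (fun j _ => hmax j) (by simp [last]) i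
      (by simpa using hi)

/-- Before `p` the selected values agree with the largest ones; from `p` on they are at most `λ_p <
σ_p`. Hence `σ_p` is the largest unselected value. -/
lemma exists_isLeast_of_not_maximal (hqr : q ≤ r) (hσ : Antitone σ) {ι : Fin q ↪ Fin r}
    (hι : Antitone fun j => σ (ι j)) (hmax : ¬ IsMaximalSelection hqr σ ι) :
    ∃ p : Fin q, IsLeast {j : Fin q | σ (ι j) < σ (Fin.castLE hqr j)} p ∧
      ∃ i, i ∉ Set.range ι ∧ σ i = σ (Fin.castLE hqr p) ∧
        ∀ i', i' ∉ Set.range ι → σ i' ≤ σ i := by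
  obtain ⟨j, hj⟩ := not_forall.1 hmax
  have hne : {j : Fin q | σ (ι j) < σ (Fin.castLE hqr j)}.Nonempty :=
    ⟨j, lt_of_le_of_ne (selected_le hqr hσ hι j) hj⟩
  obtain ⟨p, hp⟩ := (Set.toFinite _).exists_minimal hne
  have heq : ∀ j : Fin q, (j : ℕ) < p → σ (ι j) = σ (Fin.castLE hqr j) := by
    intro j hjp
    refine le_antisymm (selected_le hqr hσ hι j) (not_lt.1 fun hlt => ?_)
    exact absurd (hp.le_of_le hlt (Fin.le_def.2 hjp.le)) (not_le.2 hjp)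
  have hle : ((Fin.castLE hqr p : Fin r) : ℕ) ≤ q := p.2.le
  refine ⟨p, ⟨hp.prop, fun j hj => ?_⟩, ?_⟩
  · by_contra! h
    exact absurd (hp.le_of_le hj h.le) (not_le.2 h)
  · obtain ⟨i, hi, hi'⟩ := exists_unselected_eq hqr hσ (Fin.castLE hqr p) heq hle
      fun j hj => (hι (Fin.le_def.2 hj)).trans_lt hp.prop
    exact ⟨i, hi, hi', fun i' h' => hi' ▸ unselected_le hqr hσ _ heq hle i' h'⟩

lemma lt_of_notMem_range (ι : Fin q ↪ Fin r) {i : Fin r} (hi : i ∉ Set.range ι) : q < r := by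
  have h := Fintype.card_lt_of_injective_of_notMem ι ι.injective hi
  simpa using h

/-- Without unused columns in the factorization. -/
lemma isMinEigenvalue_of_eq (hsvd : IsCompactSVD X U σ V) (ι : Fin q ↪ Fin r)
    (hι : Antitone fun j => σ (ι j)) {i : Fin r} (hi : i ∉ Set.range ι)
    (hmax : ∀ j, j ∉ Set.range ι → σ j ≤ σ i) (l : Fin q) (hl : ∀ l', l' ≤ l)
    (hle : σ (ι l) ≤ σ i) :
    IsMinEigenvalue (hessianMap (factorLoss q X) (balancedPoint q U σ V ι))
      (-(σ i - σ (ι l))) := by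
  have hs : ∀ l', selectedPadded q σ ι l' = σ (ι l') := fun l' => dif_pos l'.2
  have := isMinEigenvalue_balancedPoint hsvd le_rfl ι hi hmax (l := l)
    (fun l' => by rw [hs, hs]; exact hι (hl l')) (by rwa [hs])
  rwa [hs, ← neg_sub] at this

end BalancedPoint

end

theorem mainTheorem3 {m n r : ℕ} (k q : ℕ) (X : Matrix (Fin m) (Fin n) ℝ) (hr : X.rank = r)
    (U : Matrix (Fin m) (Fin r) ℝ) (σ : Fin r → ℝ) (V : Matrix (Fin n) (Fin r) ℝ)
    (hsvd : IsCompactSVD X U σ V)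
    (hq : 1 ≤ q) (hqk : q ≤ k) (hqr : q ≤ r)
    (ι : Fin q ↪ Fin r) (hι : Antitone fun j => σ (ι j)) :
    -- the point lies in the balanced set and is a critical point
    balancedPoint k U σ V ι ∈ balancedSet m k n ∧
    gradient (factorLoss k X) (balancedPoint k U σ V ι) = 0 ∧
    -- (a)
    (q = min k r → IsMaximalSelection hqr σ ι →
      ∀ z : FactorSpace m k n, factorLoss k X (balancedPoint k U σ V ι) ≤ factorLoss k X z) ∧
    -- (b)
    (q = min k r → ¬ IsMaximalSelection hqr σ ι →
      ∃ hkq : k = q, ∃ p : Fin q,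
        IsLeast {j : Fin q | σ (ι j) < σ (Fin.castLE hqr j)} p ∧
        IsMinEigenvalue (hessianMap (factorLoss k X) (balancedPoint k U σ V ι))
          (-(σ (Fin.castLE hqr p) - σ (ι ⟨k - 1, by omega⟩)))) ∧
    -- (c), maximal
    (∀ h : q < min k r, IsMaximalSelection hqr σ ι →
      IsMinEigenvalue (hessianMap (factorLoss k X) (balancedPoint k U σ V ι))
        (-σ ⟨q, lt_of_lt_of_le h (min_le_right k r)⟩)) ∧
    -- (c), not maximal
    (q < min k r → ¬ IsMaximalSelection hqr σ ι →
      ∃ p : Fin q,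
        IsLeast {j : Fin q | σ (ι j) < σ (Fin.castLE hqr j)} p ∧
        IsMinEigenvalue (hessianMap (factorLoss k X) (balancedPoint k U σ V ι))
          (-σ (Fin.castLE hqr p))) := by
  have hσ := hsvd.antitone
  refine ⟨balancedPoint_mem_balancedSet hsvd ι, gradient_balancedPoint hsvd hqk ι,
    fun hqm hmax => factorLoss_balancedPoint_le hsvd hq hqk hqr hι hqm hmax, ?_, ?_, ?_⟩
  · intro hqm hmax
    obtain ⟨p, hp, i, hi, hip, hle⟩ := exists_isLeast_of_not_maximal hqr hσ hι hmax
    -- An unselected index forces `q < r`, so the minimum of `k` and `r` is `k`.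
    have hlt := lt_of_notMem_range ι hi
    have hkq : k = q := by omega
    refine ⟨hkq, p, hp, ?_⟩
    subst hkq
    rw [← hip]
    have hl : ∀ l' : Fin k, l' ≤ ⟨k - 1, by omega⟩ := fun l' =>
      Fin.le_def.2 (Nat.le_sub_one_of_lt l'.2)
    -- The required comparison is `λ_k ≤ λ_p < σ_p`.
    exact isMinEigenvalue_of_eq hsvd ι hι hi hle _ hl
      ((hι (hl p)).trans (hip ▸ le_of_lt hp.1))
  · intro h hmax
    -- Index `q`, counted from zero, carries `σ_{q+1}`.
    obtain ⟨i, hi, hip⟩ := exists_unselected_eq (ι := ι) hqr hσ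
      ⟨q, lt_of_lt_of_le h (min_le_right k r)⟩ (fun j _ => hmax j) le_rfl
      fun j hj => absurd j.2 (not_lt.2 hj)
    rw [← hip]
    exact isMinEigenvalue_of_lt hsvd (by omega) ι hi fun j hj =>
      hip ▸ unselected_le hqr hσ _ (fun j _ => hmax j) le_rfl j hj
  · intro h hmax
    obtain ⟨p, hp, i, hi, hip, hle⟩ := exists_isLeast_of_not_maximal hqr hσ hι hmax
    refine ⟨p, hp, ?_⟩
    rw [← hip]
    exact isMinEigenvalue_of_lt hsvd (by omega) ι hi hle
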